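/- Let $\mathbb F$ be $\mathbb R$ or $\mathbb C$. Let $A$ be either (i) a CSL-algebra over $\mathbb F$, that is, $A=\mathrm{Alg}\,\mathcal L=\{T\in B(H): T(L)\subseteq L \text{ for all } L\in\mathcal L\}$ with the operator norm, where $H$ is a Hilbert space over $\mathbb F$ and $\mathcal L$ is a commutative subspace lattice on $H$ (a collection of closed subspaces of $H$ that contains $\{0\}$ and $H$, is closed under arbitrary intersections and arbitrary closed linear spans, and is such that the orthogonal projections onto its members commute pairwise); or (ii) a unital semisimple Banach algebra over $\mathbb F$, that is, a unital Banach algebra whose Jacobson radical is $\{0\}$. Let $\delta:A\to A$ be a continuous $\mathbb F$-linear map such that for all $a,b\in A$, $$ab+ba=\mathbf 1\ \Longrightarrow\ 2a\delta(b)+2b\delta(a)=\delta(\mathbf 1).$$ Then $\delta=0$. -/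

import Mathlib

/-- A subspace lattice on a Hilbert space `H`: a collection of closed subspaces that contains
`{0}` and `H` and is closed under arbitrary intersections and arbitrary closed linear spans.
In `ClosedSubmodule 𝕜 H`, `sInf` is the intersection and `sSup` is the closed linear span. -/
structure IsSubspaceLattice {𝕜 H : Type*} [RCLike 𝕜] [NormedAddCommGroup H]
    [InnerProductSpace 𝕜 H] (L : Set (ClosedSubmodule 𝕜 H)) : Prop where
  bot_mem : ⊥ ∈ L
  top_mem : ⊤ ∈ L
  sInf_mem : ∀ S ⊆ L, sInf S ∈ L
  sSup_mem : ∀ S ⊆ L, sSup S ∈ L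

/-- A commutative subspace lattice (CSL): a subspace lattice such that the orthogonal projections
of `H` onto its members commute with each other. -/
structure IsCSL {𝕜 H : Type*} [RCLike 𝕜] [NormedAddCommGroup H]
    [InnerProductSpace 𝕜 H] [CompleteSpace H] (L : Set (ClosedSubmodule 𝕜 H)) : Prop
    extends IsSubspaceLattice L where
  commute : ∀ M ∈ L, ∀ N ∈ L,
    Commute M.toSubmodule.starProjection N.toSubmodule.starProjection

/-- `Alg L`: the algebra of all bounded operators on `H` that leave every member of `L`
invariant. As a subalgebra of `H →L[𝕜] H` it carries the operator norm. -/
def latticeAlg {𝕜 H : Type*} [RCLike 𝕜] [NormedAddCommGroup H]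
    [InnerProductSpace 𝕜 H] (L : Set (ClosedSubmodule 𝕜 H)) : Subalgebra 𝕜 (H →L[𝕜] H) where
  carrier := {T | ∀ M ∈ L, ∀ x ∈ M, T x ∈ M}
  mul_mem' hS hT M hM x hx := hS M hM _ (hT M hM x hx)
  add_mem' hS hT M hM x hx := add_mem (hS M hM x hx) (hT M hM x hx)
  algebraMap_mem' c M hM x hx := by
    rw [Algebra.algebraMap_eq_smul_one]
    exact M.toSubmodule.smul_mem c hx

/-- The Jordan-left-derivation identity at pairs with `a * b + b * a = 1`. -/
def IsJordanLeftDerivableAtOne {A : Type*} [Ring A] (δ : A → A) : Prop :=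
  ∀ a b : A, a * b + b * a = 1 → 2 * a * δ b + 2 * b * δ a = δ 1

/-!
Comparing `δ` at inverses of `1 ± y` shows that `δ` is a Jordan left derivation.

On a simple module `V`, the Lie identities for `δ` imply that either `δ` maps into the annihilator
of `V` or all commutators annihilate `V`. In the latter case, `δ x • v ≠ 0` together with
`e • δ x • v = v` makes elements of norm `O(Cⁿ)` act on `v` as `n!`, which is impossible in a Banach
algebra. Hence the range of `δ` lies in the Jacobson radical.

On an operator algebra, `δ (exp (n • k)) = n • exp (n • k) * δ k` and the boundedness of
`exp (n • k)` force `δ k = 0` for skew-adjoint `k`; Chebyshev polynomials `Tₙ(h)` play the same role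
for a self-adjoint contraction `h` and avoid the imaginary unit, which is missing over `ℝ`. So `δ`
vanishes at every `x` whose adjoint lies in the algebra. In a CSL algebra the projection `E` onto
the joint kernel of the corners `P T (1 - P)` commutes with the lattice,
`δ x = E * δ x = δ (E * x * E)`, and `E * x * E` commutes with the lattice, so its adjoint lies in
the algebra.
-/

/-- A Jordan left derivation: a map with `δ (x ^ 2) = 2 x (δ x)`. Additivity is left to the bundled
type of `δ`. -/
def IsJordanLeftDerivation {A : Type*} [Ring A] (δ : A → A) : Prop :=
  ∀ x, δ (x * x) = 2 * x * δ x

lemma isUnit_two (R A : Type*) [CommSemiring R] [Invertible (2 : R)] [Semiring A] [Algebra R A] :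
    IsUnit (2 : A) := by
  simpa only [map_ofNat] using (isUnit_of_invertible (2 : R)).map (algebraMap R A)

lemma invOf_two_smul_two_mul {R A : Type*} [CommSemiring R] [Invertible (2 : R)] [Semiring A]
    [Algebra R A] (x : A) : (⅟2 : R) • (2 * x) = x := by
  rw [two_mul, ← two_smul R, smul_smul, invOf_mul_self, one_smul]

lemma mul_self_mul_inv_mul_inv_of_commute {G : Type*} [Group G] {v w : G} (h : Commute v w) :
    v * w * (v * w) * (v⁻¹ * v⁻¹) = w * w := by
  have hcomm : Commute (v * w) v⁻¹ := ((Commute.refl v).mul_left h.symm).inv_right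
  rw [hcomm.mul_mul_mul_comm, h.eq, mul_inv_cancel_right]

lemma two_mul_inv_mul_of_commute {A : Type*} [Ring A] {v w : Aˣ} (h : Commute v w)
    (hvw : (v + w : A) = 2) : (2 * ↑(v * w)⁻¹ : A) = ↑v⁻¹ + ↑w⁻¹ := by
  have hv : (v * w * ↑v⁻¹ : A) = w := by
    exact_mod_cast congrArg Units.val (mul_inv_eq_of_eq_mul h.eq)
  have hw : (v * w * ↑w⁻¹ : A) = v := by rw [mul_assoc, w.mul_inv, mul_one]
  refine (v * w).isUnit.mul_left_cancel ?_
  rw [two_mul, mul_add, Units.mul_inv, one_add_one_eq_two, Units.val_mul, mul_add, hv, hw,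
    add_comm, hvw]

namespace IsJordanLeftDerivableAtOne

variable {R A F : Type*} [CommRing R] [Invertible (2 : R)] [Ring A] [Algebra R A] [FunLike F A A]
  [LinearMapClass F R A A] {δ : F} (hδ : IsJordanLeftDerivableAtOne δ)
include R hδ

lemma map_one : δ 1 = 0 := by
  have h := hδ 1 ((⅟2 : R) • 1) (by rw [one_mul, mul_one, ← two_mul, mul_smul_comm,
    invOf_two_smul_two_mul])
  rw [mul_one, map_smul, mul_smul_comm, mul_smul_comm, invOf_two_smul_two_mul,
    invOf_two_smul_two_mul, one_mul] at h
  exact add_eq_left.1 h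

lemma map_inv (u : Aˣ) : δ ↑u⁻¹ = -(↑u⁻¹ * ↑u⁻¹ * δ u) := by
  have h := hδ u ((⅟2 : R) • ↑u⁻¹) (by
    rw [mul_smul_comm, smul_mul_assoc, u.mul_inv, u.inv_mul, ← two_mul, mul_smul_comm,
      invOf_two_smul_two_mul])
  rw [hδ.map_one, map_smul, mul_smul_comm, mul_assoc, invOf_two_smul_two_mul, mul_smul_comm,
    smul_mul_assoc, mul_assoc, invOf_two_smul_two_mul] at h
  rw [mul_assoc, ← mul_neg, ← eq_neg_of_add_eq_zero_left h, u.inv_mul_cancel_left]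

/-- By `2 (1 - y²)⁻¹ = (1 + y)⁻¹ + (1 - y)⁻¹`, the formula for `δ` at inverses determines `δ` at
the square `y²`. -/
lemma map_mul_self_of_isUnit {y : A} (hadd : IsUnit (1 + y)) (hsub : IsUnit (1 - y)) :
    δ (y * y) = 2 * y * δ y := by
  obtain ⟨v, hv⟩ := hadd
  obtain ⟨w, hw⟩ := hsub
  have hvw : Commute v w := Units.ext (by rw [Units.val_mul, Units.val_mul, hv, hw]; noncomm_ring)
  obtain ⟨u, hu⟩ : ∃ u, u = v * w := ⟨_, rfl⟩
  have hinv : (2 * ↑u⁻¹ : A) = ↑v⁻¹ + ↑w⁻¹ := by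
    rw [hu, two_mul_inv_mul_of_commute hvw (by rw [hv, hw, add_add_sub_cancel, one_add_one_eq_two])]
  have hδv : δ v = δ y := by rw [hv, map_add, hδ.map_one, zero_add]
  have hδw : δ w = -δ y := by rw [hw, map_sub, hδ.map_one, zero_sub]
  have hδu : δ u = -δ (y * y) := by
    rw [hu, Units.val_mul, hv, hw, show (1 + y) * (1 - y) = 1 - y * y by noncomm_ring, map_sub,
      hδ.map_one, zero_sub]
  have hδinv : u * u * δ ↑u⁻¹ = δ (y * y) := by
    simp only [hδ.map_inv, hδu, mul_neg, neg_neg, mul_assoc, u.mul_inv_cancel_left]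
  have hvv : (u * u * (↑v⁻¹ * ↑v⁻¹) : A) = w * w := by
    exact_mod_cast congrArg Units.val (hu ▸ mul_self_mul_inv_mul_inv_of_commute hvw)
  have hww : (u * u * (↑w⁻¹ * ↑w⁻¹) : A) = v * v := by
    rw [hu, hvw.eq]
    exact_mod_cast congrArg Units.val (mul_self_mul_inv_mul_inv_of_commute hvw.symm)
  refine (isUnit_two R A).mul_left_cancel ?_
  calc 2 * δ (y * y) = u * u * δ (2 * ↑u⁻¹) := by
        rw [← hδinv, two_mul, two_mul, map_add, mul_add]
    _ = (v * v - w * w) * δ y := by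
        rw [hinv, map_add, hδ.map_inv, hδ.map_inv, hδv, hδw, ← hvv, ← hww]
        noncomm_ring
    _ = 2 * (2 * y * δ y) := by
        rw [hv, hw]
        noncomm_ring

end IsJordanLeftDerivableAtOne

namespace IsJordanLeftDerivation

section Additive

variable {A F : Type*} [Ring A] [FunLike F A A] [AddMonoidHomClass F A A] {δ : F}
  (hδ : IsJordanLeftDerivation δ)
include hδ

lemma map_mul_add_mul (x y : A) : δ (x * y + y * x) = 2 * x * δ y + 2 * y * δ x := by
  have h := hδ (x + y)
  rw [show (x + y) * (x + y) = x * x + y * y + (x * y + y * x) by noncomm_ring, map_add, map_add,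
    hδ, hδ, map_add δ x y] at h
  linear_combination (norm := noncomm_ring) h

omit [AddMonoidHomClass F A A] in
lemma map_one : δ 1 = 0 := by
  have h := hδ 1
  rw [mul_one, mul_one] at h
  linear_combination (norm := noncomm_ring) -h

end Additive

section TwoInvertible

variable {R A F : Type*} [CommRing R] [Invertible (2 : R)] [Ring A] [Algebra R A] [FunLike F A A]
  [LinearMapClass F R A A] {δ : F} (hδ : IsJordanLeftDerivation δ)
include R hδ

lemma map_mul_of_commute {x y : A} (h : Commute x y) : δ (x * y) = x * δ y + y * δ x := by
  refine (isUnit_two R A).mul_left_cancel ?_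
  have h' := hδ.map_mul_add_mul x y
  rw [← h.eq, map_add] at h'
  linear_combination (norm := noncomm_ring) h'

lemma map_pow_succ (x : A) (n : ℕ) : δ (x ^ (n + 1)) = (n + 1) • (x ^ n * δ x) := by
  induction n with
  | zero => simp
  | succ n ih =>
    rw [pow_succ', hδ.map_mul_of_commute (Commute.self_pow x (n + 1)), ih, mul_smul_comm,
      ← mul_assoc, ← pow_succ', ← succ_nsmul]

lemma map_mul_mul (x y : A) :
    δ (x * y * x) = x * x * δ y + 3 * x * y * δ x - y * x * δ x := by
  have hnested := hδ.map_mul_add_mul x (x * y + y * x)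
  have hsq := hδ.map_mul_add_mul (x * x) y
  rw [show x * (x * y + y * x) + (x * y + y * x) * x
    = (x * x * y + y * (x * x)) + (x * y * x + x * y * x) by noncomm_ring, map_add, hsq, map_add,
    hδ.map_mul_add_mul x y, hδ] at hnested
  refine (isUnit_two R A).mul_left_cancel ?_
  linear_combination (norm := noncomm_ring) hnested

lemma map_mul_mul_add (x y z : A) :
    δ (x * y * z + z * y * x) = (x * z + z * x) * δ y + 3 * x * y * δ z + 3 * z * y * δ x
      - y * x * δ z - y * z * δ x := by
  have h := hδ.map_mul_mul (x + z) y
  rw [show (x + z) * y * (x + z) = x * y * x + z * y * z + (x * y * z + z * y * x) by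
    noncomm_ring, map_add, map_add, hδ.map_mul_mul, hδ.map_mul_mul, map_add δ x z] at h
  linear_combination (norm := noncomm_ring) h

lemma lie_mul_map_mul (x y : A) :
    ⁅x, y⁆ * δ (x * y) = x * ⁅x, y⁆ * δ y + y * ⁅x, y⁆ * δ x := by
  have htriple := hδ.map_mul_mul_add x y (x * y)
  have hsq := hδ.map_mul_mul x (y * y)
  rw [hδ] at hsq
  rw [map_add, hδ, show x * y * y * x = x * (y * y) * x by noncomm_ring, hsq] at htriple
  simp only [Ring.lie_def]
  linear_combination (norm := noncomm_ring) -htriple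

lemma lie_lie_mul_map (x y : A) : ⁅x, ⁅x, y⁆⁆ * δ x = 0 := by
  have h := hδ.lie_mul_map_mul x y
  have h' := hδ.lie_mul_map_mul x (y + x)
  rw [mul_add, map_add, map_add, hδ] at h'
  refine (isUnit_two R A).mul_left_cancel ?_
  simp only [Ring.lie_def] at h h' ⊢
  linear_combination (norm := noncomm_ring) h - h'

lemma lie_mul_map_lie (x y : A) : ⁅x, y⁆ * δ ⁅x, y⁆ = 0 := by
  have hxy := hδ.lie_mul_map_mul x y
  have hyx := hδ.lie_mul_map_mul y x
  rw [Ring.lie_def, map_sub]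
  simp only [Ring.lie_def] at hxy hyx
  linear_combination (norm := noncomm_ring) hxy + hyx

lemma lie_mul_map_lie_add (x y z : A) : ⁅x, y⁆ * δ ⁅x, z⁆ + ⁅x, z⁆ * δ ⁅x, y⁆ = 0 := by
  have h := hδ.lie_mul_map_lie x (y + z)
  rw [show ⁅x, y + z⁆ = ⁅x, y⁆ + ⁅x, z⁆ by simp only [Ring.lie_def]; noncomm_ring, map_add,
    add_mul, mul_add, mul_add, hδ.lie_mul_map_lie, hδ.lie_mul_map_lie] at h
  linear_combination (norm := noncomm_ring) h

lemma lie_lie_mul_map_add (a y z : A) :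
    (⁅a, ⁅z, y⁆⁆ + ⁅z, ⁅a, y⁆⁆) * δ a + ⁅a, ⁅a, y⁆⁆ * δ z = 0 := by
  have hadd := hδ.lie_lie_mul_map (a + z) y
  have hsub := hδ.lie_lie_mul_map (a - z) y
  have hz := hδ.lie_lie_mul_map z y
  refine (isUnit_two R A).mul_left_cancel ?_
  simp only [Ring.lie_def, map_add, map_sub] at hadd hsub hz ⊢
  linear_combination (norm := noncomm_ring) hadd - hsub - 2 * hz

lemma map_lie_lie (a y : A) : δ ⁅a, ⁅a, y⁆⁆ = -(6 * ⁅a, y⁆ * δ a) := by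
  have hsq := hδ.map_mul_add_mul (a * a) y
  rw [hδ] at hsq
  rw [show ⁅a, ⁅a, y⁆⁆ = (a * a * y + y * (a * a)) - (a * y * a + a * y * a) by
    simp only [Ring.lie_def]; noncomm_ring, map_sub, map_add δ (a * y * a), hsq, hδ.map_mul_mul,
    Ring.lie_def]
  noncomm_ring

lemma lie_mul_lie_mul_map (a y : A) : ⁅a, y⁆ * ⁅a, y⁆ * δ a = 0 := by
  obtain ⟨x, hx⟩ : ∃ x, x = ⁅a, y⁆ := ⟨_, rfl⟩
  obtain ⟨v, hv⟩ : ∃ v, v = ⁅a, x⁆ := ⟨_, rfl⟩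
  have hva : v * δ a = 0 := by rw [hv, hx, hδ.lie_lie_mul_map]
  have hvx : v * δ x = 6 * (x * x * δ a) := by
    have h := hδ.lie_mul_map_lie_add a y x
    rw [← hx, ← hv, hv, hx, hδ.map_lie_lie, ← hx, ← hv] at h
    linear_combination (norm := noncomm_ring) h
  have hlinearized : v * y * δ a + v * δ x = 0 := by
    have h := hδ.lie_lie_mul_map_add a y x
    have hlie : ⁅a, ⁅x, y⁆⁆ = v * y - y * v := by
      simp only [hv, Ring.lie_def] at hx ⊢
      linear_combination (norm := noncomm_ring) hx * x - x * hx
    rw [← hx, Ring.lie_def x x, sub_self, add_zero, ← hv, hlie] at h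
    linear_combination (norm := noncomm_ring) h + y * hva
  have hsq : v * y * δ a + 2 * (x * x * δ a) = 0 := by
    have h := hδ.lie_lie_mul_map a (y * y)
    rw [show ⁅a, ⁅a, y * y⁆⁆ = v * y + 2 * (x * x) + y * v by
      simp only [hv, hx, Ring.lie_def]; noncomm_ring] at h
    linear_combination (norm := noncomm_ring) h - y * hva
  rw [← hx]
  refine (isUnit_two R A).mul_left_cancel ((isUnit_two R A).mul_left_cancel ?_)
  linear_combination (norm := noncomm_ring) hlinearized - hsq - hvx

end TwoInvertible

end IsJordanLeftDerivation

section Scaling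

variable {𝕜 : Type*} [RCLike 𝕜]

variable (𝕜) in
lemma exists_pos_norm_smul_lt_one {E : Type*} [SeminormedAddCommGroup E] [NormedSpace 𝕜 E]
    (x : E) : ∃ c : ℝ, 0 < c ∧ ‖(c : 𝕜) • x‖ < 1 := by
  obtain ⟨c, hc, hlt⟩ := exists_pos_mul_lt one_pos ‖x‖
  exact ⟨c, hc, by rwa [norm_smul, RCLike.norm_of_nonneg hc.le, mul_comm]⟩

lemma IsJordanLeftDerivableAtOne.isJordanLeftDerivation {A : Type*} [NormedRing A]
    [NormedAlgebra 𝕜 A] [HasSummableGeomSeries A] {F : Type*} [FunLike F A A]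
    [LinearMapClass F 𝕜 A A] {δ : F} (hδ : IsJordanLeftDerivableAtOne δ) :
    IsJordanLeftDerivation δ := by
  intro x
  obtain ⟨c, hc, hlt⟩ := exists_pos_norm_smul_lt_one 𝕜 x
  have hsub : IsUnit (1 - (c : 𝕜) • x) := (Units.oneSub _ hlt).isUnit
  have hadd : IsUnit (1 + (c : 𝕜) • x) := by
    rw [← norm_neg] at hlt
    simpa only [Units.val_oneSub, sub_neg_eq_add] using (Units.oneSub _ hlt).isUnit
  have hc' : (c : 𝕜) ≠ 0 := RCLike.ofReal_ne_zero.2 hc.ne'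
  have hscaled := hδ.map_mul_self_of_isUnit hadd hsub
  refine smul_right_injective A (mul_ne_zero hc' hc') ?_
  simpa only [map_smul, smul_mul_smul_comm, mul_smul_comm, smul_mul_assoc, smul_smul]
    using hscaled

end Scaling

theorem mem_jacobson_of_forall_smul_eq_zero {A : Type*} [Ring A] {x : A}
    (h : ∀ (M : Ideal A) [IsSimpleModule A (A ⧸ M)] (v : A ⧸ M), x • v = 0) :
    x ∈ Ring.jacobson A := by
  rw [Ring.jacobson_eq_sInf_isMaximal, Submodule.mem_sInf]
  intro M hM
  have : IsSimpleModule A (A ⧸ M) := isSimpleModule_iff_isCoatom.2 (Ideal.isMaximal_def.1 hM)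
  have h1 := h M (Submodule.Quotient.mk 1)
  rwa [← Submodule.Quotient.mk_smul, smul_eq_mul, mul_one, Submodule.Quotient.mk_eq_zero] at h1

section SimpleModule

variable {A V : Type*} [Ring A] [AddCommGroup V] [Module A V] [IsSimpleModule A V] {a : A} {w : V}

lemma exists_smul_eq_of_isSimpleModule (hw : w ≠ 0) (v : V) : ∃ r : A, r • w = v :=
  IsSimpleModule.toSpanSingleton_surjective A hw v

lemma lie_smul_eq_zero_of_lie_smul (hw : w ≠ 0) (h : ∀ x : A, ⁅a, x⁆ • w = 0) (x : A) (v : V) :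
    ⁅a, x⁆ • v = 0 := by
  obtain ⟨r, rfl⟩ := exists_smul_eq_of_isSimpleModule (A := A) hw v
  have hleib : ⁅a, x⁆ * r = ⁅a, x * r⁆ - x * ⁅a, r⁆ := by simp only [Ring.lie_def]; noncomm_ring
  rw [← mul_smul, hleib, sub_smul, mul_smul, h, h, smul_zero, sub_zero]

lemma lie_smul_eq_zero_of_smul_smul_ne_zero (h2 : IsUnit (2 : A))
    (hlie : ∀ x : A, ⁅a, ⁅a, x⁆⁆ • w = 0) {s : A} (hs : s • w = 0) (hsa : s • a • w ≠ 0)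
    (x : A) (v : V) : ⁅a, x⁆ • v = 0 := by
  refine lie_smul_eq_zero_of_lie_smul hsa (fun r ↦ ?_) x v
  have hleib : 2 * (⁅a, r⁆ * (s * a)) = ⁅a, ⁅a, r⁆⁆ * s + 2 * ⁅a, r⁆ * (a * s) + r * ⁅a, ⁅a, s⁆⁆
      - ⁅a, ⁅a, r * s⁆⁆ := by
    simp only [Ring.lie_def]; noncomm_ring
  have h : (2 : A) • ⁅a, r⁆ • s • a • w = 0 := by
    simp only [← mul_smul]
    simp only [mul_assoc, hleib, sub_smul, add_smul]
    simp only [mul_smul, hs, hlie, smul_zero, add_zero, sub_zero]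
  exact h2.smul_eq_zero.1 h

lemma lie_smul_eq_zero_of_smul_smul_eq_zero (hlie : ∀ x : A, ⁅a, ⁅a, x⁆⁆ • w = 0)
    (hsq : ∀ x : A, (⁅a, x⁆ * ⁅a, x⁆) • w = 0) (hinv : ∀ s : A, s • w = 0 → s • a • w = 0) (x : A) :
    ⁅a, x⁆ • w = 0 := by
  have hann {s : A} (hs : s • w = 0) : ⁅a, s⁆ • w = 0 := by
    rw [Ring.lie_def, sub_smul, mul_smul, mul_smul, hs, smul_zero, hinv s hs, sub_zero]
  by_contra hx
  have hannx {s : A} (hs : s • w = 0) : ⁅a, s⁆ • ⁅a, x⁆ • w = 0 := by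
    have hpol : ⁅a, s⁆ * ⁅a, x⁆ = ⁅a, x + s⁆ * ⁅a, x + s⁆ - ⁅a, x⁆ * ⁅a, x⁆ - ⁅a, s⁆ * ⁅a, s⁆
        - ⁅a, x⁆ * ⁅a, s⁆ := by
      simp only [Ring.lie_def]; noncomm_ring
    rw [← mul_smul, hpol, sub_smul, sub_smul, sub_smul, hsq, hsq, hsq, mul_smul, hann hs]
    simp only [smul_zero, sub_zero]
  obtain ⟨r, hr⟩ := exists_smul_eq_of_isSimpleModule (A := A) hx w
  have hs : (r * ⁅a, x⁆ - 1) • w = 0 := by rw [sub_smul, mul_smul, hr, one_smul, sub_self]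
  have hsx : (r * ⁅a, x⁆ - 1) • ⁅a, x⁆ • w ≠ 0 := by
    rwa [sub_smul, one_smul, mul_smul, ← mul_smul ⁅a, x⁆, hsq, smul_zero, zero_sub, neg_ne_zero]
  obtain ⟨t, ht⟩ := exists_smul_eq_of_isSimpleModule (A := A) hsx (x • w)
  have hsxw : (x - t * (r * ⁅a, x⁆ - 1) * ⁅a, x⁆) • w = 0 := by
    rw [sub_smul, mul_smul, mul_smul, ht, sub_self]
  have hts : (t * (r * ⁅a, x⁆ - 1)) • w = 0 := by rw [mul_smul, hs, smul_zero]
  have hleib (s : A) : ⁅a, x⁆ = ⁅a, x - s * ⁅a, x⁆⁆ + ⁅a, s⁆ * ⁅a, x⁆ + s * ⁅a, ⁅a, x⁆⁆ := by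
    simp only [Ring.lie_def]; noncomm_ring
  apply hx
  rw [hleib (t * (r * ⁅a, x⁆ - 1)), add_smul, add_smul, hann hsxw, mul_smul, hannx hts, mul_smul,
    hlie, smul_zero, add_zero, add_zero]

theorem lie_smul_eq_zero_of_isSimpleModule (h2 : IsUnit (2 : A)) (hw : w ≠ 0)
    (hlie : ∀ x : A, ⁅a, ⁅a, x⁆⁆ • w = 0) (hsq : ∀ x : A, (⁅a, x⁆ * ⁅a, x⁆) • w = 0) (x : A)
    (v : V) : ⁅a, x⁆ • v = 0 := by
  by_cases hinv : ∀ s : A, s • w = 0 → s • a • w = 0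
  · exact lie_smul_eq_zero_of_lie_smul hw
      (lie_smul_eq_zero_of_smul_smul_eq_zero hlie hsq hinv) x v
  · push Not at hinv
    obtain ⟨s, hs, hsa⟩ := hinv
    exact lie_smul_eq_zero_of_smul_smul_ne_zero h2 hlie hs hsa x v

namespace IsJordanLeftDerivation

variable {R F : Type*} [CommRing R] [Invertible (2 : R)] [Algebra R A] [FunLike F A A]
  [LinearMapClass F R A A] {δ : F} (hδ : IsJordanLeftDerivation δ)
include R hδ

variable (V) in
theorem map_smul_eq_zero_or_lie_smul_eq_zero :
    (∀ (x : A) (v : V), δ x • v = 0) ∨ ∀ (x y : A) (v : V), ⁅x, y⁆ • v = 0 := by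
  refine or_iff_not_imp_left.2 fun h ↦ ?_
  push Not at h
  obtain ⟨a, w, ha⟩ := h
  have hlie {b : A} (hb : δ b • w ≠ 0) (y : A) (v : V) : ⁅b, y⁆ • v = 0 :=
    lie_smul_eq_zero_of_isSimpleModule (isUnit_two R A) hb
      (fun x ↦ by rw [← mul_smul, hδ.lie_lie_mul_map, zero_smul])
      (fun x ↦ by rw [← mul_smul, hδ.lie_mul_lie_mul_map, zero_smul]) y v
  intro x y v
  by_cases hx : δ x • w = 0
  · have hxa : δ (x + a) • w ≠ 0 := by rwa [map_add, add_smul, hx, zero_add]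
    rw [show ⁅x, y⁆ = ⁅x + a, y⁆ - ⁅a, y⁆ by simp only [Ring.lie_def]; noncomm_ring, sub_smul,
      hlie hxa, hlie ha, sub_zero]
  · exact hlie hx y v

lemma lie_map_eq_zero (hA : Ring.jacobson A = ⊥) (x y : A) : ⁅δ x, y⁆ = 0 := by
  rw [← Ideal.mem_bot, ← hA]
  refine mem_jacobson_of_forall_smul_eq_zero fun M _ v ↦ ?_
  obtain h | h := hδ.map_smul_eq_zero_or_lie_smul_eq_zero (A ⧸ M)
  · rw [Ring.lie_def, sub_smul, mul_smul, mul_smul, h, h, smul_zero, sub_zero]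
  · exact h _ _ v

end IsJordanLeftDerivation

end SimpleModule

section Banach

open Filter
open scoped Nat

variable {𝕜 A V : Type*} [RCLike 𝕜] [NormedRing A] [NormedAlgebra 𝕜 A] [AddCommGroup V]
  [Module A V]

include 𝕜 in
lemma eq_zero_of_smul_eq_factorial_nsmul [CompleteSpace A] {v : V} {y : ℕ → A} {C : ℝ}
    (hy : ∀ n, 0 < n → ‖y n‖ ≤ C ^ n) (hv : ∀ n, y n • v = n ! • v) : v = 0 := by
  obtain ⟨n, hlt, hn⟩ := (((FloorSemiring.tendsto_pow_div_factorial_atTop C).eventually_lt_const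
    one_pos).and (eventually_gt_atTop 0)).exists
  have hfac : (n ! : 𝕜) ≠ 0 := Nat.cast_ne_zero.2 (Nat.factorial_ne_zero n)
  have hnorm : ‖(n ! : 𝕜)⁻¹ • y n‖ < 1 := by
    rw [norm_smul, norm_inv, RCLike.norm_natCast, inv_mul_eq_div]
    exact (div_le_div_of_nonneg_right (hy n hn) (Nat.cast_nonneg _)).trans_lt hlt
  have hfix : ((n ! : 𝕜)⁻¹ • y n) • v = v := by
    rw [Algebra.smul_def, mul_smul, hv, ← Nat.cast_smul_eq_nsmul A, ← mul_smul,
      ← map_natCast (algebraMap 𝕜 A), ← map_mul, inv_mul_cancel₀ hfac, map_one, one_smul]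
  rw [← (Units.oneSub _ hnorm).isUnit.smul_eq_zero, Units.val_oneSub, sub_smul, one_smul, hfix,
    sub_self]

lemma norm_pow_apply_pow_le (f : A →L[𝕜] A) (x : A) {n : ℕ} (hn : 0 < n) :
    ‖(f ^ n) (x ^ n)‖ ≤ (‖f‖ * ‖x‖) ^ n := by
  rw [mul_pow]
  exact (f ^ n).le_of_opNorm_le_of_le (norm_pow_le' f hn) (norm_pow_le' x hn)

namespace IsJordanLeftDerivation

variable {δ : A →L[𝕜] A} (hδ : IsJordanLeftDerivation δ) (hcomm : ∀ x y, Commute (δ x) y) {v : V}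
include hδ hcomm

lemma pow_apply_mul_smul {n : ℕ} {y : A} (hy : ∀ i < n, (δ ^ i) y • v = 0) (x : A) :
    (δ ^ n) (δ x * y) • v = δ x • (δ ^ n) y • v := by
  induction n generalizing x y with
  | zero => exact mul_smul _ _ _
  | succ n ih =>
    rw [pow_succ, mul_apply_eq_comp, mul_apply_eq_comp,
      hδ.map_mul_of_commute (hcomm x y), ← (hcomm (δ x) y).eq, map_add, add_smul,
      ih (fun i hi ↦ by simpa [pow_succ] using hy (i + 1) (by lia)) x,
      ih (fun i hi ↦ hy i (by lia)) (δ x), hy n (by lia), smul_zero, add_zero]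

lemma pow_apply_pow_smul {a : A} (ha : a • v = 0) (n : ℕ) :
    (∀ i < n, (δ ^ i) (a ^ n) • v = 0) ∧ (δ ^ n) (a ^ n) • v = n ! • δ a ^ n • v := by
  induction n with
  | zero => simp
  | succ n ih =>
    obtain ⟨hlow, htop⟩ := ih
    have hstep {i : ℕ} (hi : i ≤ n) :
        (δ ^ (i + 1)) (a ^ (n + 1)) • v = (n + 1) • δ a • (δ ^ i) (a ^ n) • v := by
      rw [pow_succ, mul_apply_eq_comp, hδ.map_pow_succ, map_nsmul,
        ← (hcomm a (a ^ n)).eq, smul_assoc,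
        hδ.pow_apply_mul_smul hcomm (fun j hj ↦ hlow j (hj.trans_le hi))]
    refine ⟨fun i hi ↦ ?_, ?_⟩
    · cases i with
      | zero => simp [pow_succ, mul_smul, ha]
      | succ i => rw [hstep (by lia), hlow i (by lia), smul_zero, smul_zero]
    · rw [hstep le_rfl, htop, smul_comm (δ a), ← mul_smul (δ a), ← pow_succ', ← mul_smul,
        Nat.factorial_succ]

variable [CompleteSpace A] [IsSimpleModule A V]

lemma map_smul_eq_zero_of_smul_eq_zero {a : A} (ha : a • v = 0) : δ a • v = 0 := by
  by_contra hne
  obtain ⟨e, he⟩ := exists_smul_eq_of_isSimpleModule (A := A) hne v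
  have hfix (n : ℕ) : e ^ n • δ a ^ n • v = v := by
    rw [← mul_smul, ← (hcomm a e).symm.mul_pow]
    induction n with
    | zero => rw [pow_zero, one_smul]
    | succ n ih => rw [pow_succ, mul_smul, mul_smul, he, ih]
  have hv : v = 0 := by
    refine eq_zero_of_smul_eq_factorial_nsmul (𝕜 := 𝕜) (y := fun n ↦ e ^ n * (δ ^ n) (a ^ n))
      (C := ‖e‖ * (‖δ‖ * ‖a‖)) (fun n hn ↦ ?_) fun n ↦ ?_
    · rw [mul_pow]
      exact norm_mul_le_of_le (norm_pow_le' e hn) (norm_pow_apply_pow_le δ a hn)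
    · rw [mul_smul, (hδ.pow_apply_pow_smul hcomm ha n).2, smul_comm, hfix]
  exact hne (by rw [hv, smul_zero])

lemma map_smul_eq_zero_of_lie_smul_eq_zero (hlie : ∀ (x y : A) (v : V), ⁅x, y⁆ • v = 0) (x : A)
    (v : V) : δ x • v = 0 := by
  by_contra hne
  obtain ⟨e, he⟩ := exists_smul_eq_of_isSimpleModule (A := A) hne v
  obtain ⟨f, hf⟩ : ∃ f : A →L[𝕜] A, ∀ y, f y = e * δ y :=
    ⟨ContinuousLinearMap.mul 𝕜 A e ∘L δ, fun _ ↦ rfl⟩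
  have hann (n : ℕ) {s : A} (hs : s • v = 0) : (f ^ n) s • v = 0 := by
    induction n with
    | zero => exact hs
    | succ n ih =>
      rw [pow_succ', mul_apply_eq_comp, hf, mul_smul,
        hδ.map_smul_eq_zero_of_smul_eq_zero hcomm ih, smul_zero]
  have hderiv (n : ℕ) : (f (x ^ (n + 1)) - (n + 1) • x ^ n) • v = 0 := by
    have hswap : e • x ^ n • δ x • v = x ^ n • e • δ x • v := by
      rw [← mul_smul e, ← mul_smul (x ^ n), ← sub_eq_zero, ← sub_smul, ← Ring.lie_def, hlie]
    rw [hf, hδ.map_pow_succ, mul_smul_comm, ← smul_sub, smul_assoc, sub_smul, mul_smul, mul_smul,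
      hswap, he, sub_self, smul_zero]
  have hfac (n : ℕ) : (f ^ n) (x ^ n) • v = n ! • v := by
    induction n with
    | zero => simp
    | succ n ih =>
      have h := hann n (hderiv n)
      rw [map_sub, sub_smul, sub_eq_zero, map_nsmul, smul_assoc, ih, ← mul_smul,
        ← Nat.factorial_succ] at h
      rwa [pow_succ, mul_apply_eq_comp]
  have hv : v = 0 := eq_zero_of_smul_eq_factorial_nsmul (𝕜 := 𝕜)
    (fun n hn ↦ norm_pow_apply_pow_le f x hn) hfac
  exact hne (by rw [hv, smul_zero])

omit hcomm [AddCommGroup V] [Module A V] [IsSimpleModule A V] in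
theorem eq_zero_of_jacobson_eq_bot (hA : Ring.jacobson A = ⊥) : δ = 0 := by
  have hcomm (x y : A) : Commute (δ x) y := sub_eq_zero.1 (hδ.lie_map_eq_zero hA x y)
  ext x
  rw [zero_apply, ← Ideal.mem_bot, ← hA]
  refine mem_jacobson_of_forall_smul_eq_zero fun M _ v ↦ ?_
  obtain h | h := hδ.map_smul_eq_zero_or_lie_smul_eq_zero (A ⧸ M)
  · exact h x v
  · exact hδ.map_smul_eq_zero_of_lie_smul_eq_zero hcomm h x v

end IsJordanLeftDerivation

end Banach

section Chebyshev

open Polynomial Chebyshev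

lemma chebyshev_pell (n : ℤ) :
    T ℤ n ^ 2 + (1 - X ^ 2) * U ℤ (n - 1) ^ 2 = 1 := by
  have h := congrArg (fun p : ℤ[X] ↦ p.comp (2 * X)) (S_sq_add_S_sq ℤ (n - 1))
  simp only [add_comp, sub_comp, mul_comp, pow_comp, X_comp, one_comp,
    S_comp_two_mul_X, sub_add_cancel] at h
  rw [T_eq_U_sub_X_mul_U]
  linear_combination h

/-- In terms of `x = cos θ` and `S = (1 - X ^ 2) Uₙ₋₁`, where `Tₙ(x) = cos nθ` and
`S(x) = sin θ sin nθ`, this is `n (S T' - T S') - X T T' = n²`. -/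
lemma chebyshev_wronskian (n : ℤ) :
    (n : ℤ[X]) * ((1 - X ^ 2) * U ℤ (n - 1) * derivative (T ℤ n)
        - T ℤ n * derivative ((1 - X ^ 2) * U ℤ (n - 1)))
      - X * T ℤ n * derivative (T ℤ n) = (n : ℤ[X]) ^ 2 := by
  have hS : derivative ((1 - X ^ 2) * U ℤ (n - 1))
      = -(X * U ℤ (n - 1)) - (n : ℤ[X]) * T ℤ n := by
    have h := add_one_mul_T_eq_poly_in_U (R := ℤ) (n - 1)
    rw [Int.cast_sub, Int.cast_one, sub_add_cancel, sub_add_cancel] at h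
    simp only [derivative_mul, derivative_sub, derivative_one, derivative_X_sq, map_ofNat]
    linear_combination h
  rw [T_derivative_eq_U, hS]
  linear_combination (n : ℤ[X]) ^ 2 * chebyshev_pell n

end Chebyshev

namespace IsJordanLeftDerivation

section Idempotent

variable {A F : Type*} [Ring A] [FunLike F A A] [AddMonoidHomClass F A A] {δ : F}
  (hδ : IsJordanLeftDerivation δ)
include hδ

omit [AddMonoidHomClass F A A] in
lemma map_idempotent {e : A} (he : IsIdempotentElem e) : δ e = 0 := by
  have h := hδ e
  rw [he] at h
  have hzero : e * δ e = 0 := by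
    linear_combination (norm := noncomm_ring) -e * h - 2 * congrArg (· * δ e) he.eq
  rw [h, mul_assoc, hzero, mul_zero]

lemma map_eq_zero_of_mul_eq {p y : A} (hp : IsIdempotentElem p) (hpy : p * y = y)
    (hyp : y * p = 0) : δ y = 0 := by
  have h := hδ.map_mul_add_mul p y
  rw [hpy, hyp, add_zero, hδ.map_idempotent hp, mul_zero, add_zero] at h
  have hzero : p * δ y = 0 := by
    linear_combination (norm := noncomm_ring) -p * h - 2 * congrArg (· * δ y) hp.eq
  rw [h, mul_assoc, hzero, mul_zero]

end Idempotent

section TwoInvertible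

open Polynomial Chebyshev

variable {R A F : Type*} [CommRing R] [Invertible (2 : R)] [Ring A] [Algebra R A] [FunLike F A A]
  [LinearMapClass F R A A] {δ : F} (hδ : IsJordanLeftDerivation δ)
include R hδ

lemma map_idempotent_mul_mul {e : A} (he : IsIdempotentElem e) (x : A) :
    δ (e * x * e) = e * δ x := by
  rw [hδ.map_mul_mul, hδ.map_idempotent he, he.eq, mul_zero, mul_zero, add_zero, sub_zero]

lemma mul_mul_one_sub_mul_map {p : A} (hp : IsIdempotentElem p) (hinv : ∀ x, p * x * p = x * p)
    (t x : A) : p * t * (1 - p) * δ x = 0 := by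
  obtain ⟨z, hz⟩ : ∃ z, z = p * t * (1 - p) := ⟨_, rfl⟩
  have hpz : p * z = z := by rw [hz, ← mul_assoc, ← mul_assoc, hp.eq]
  have hzp : z * p = 0 := by rw [hz, mul_assoc, hp.one_sub_mul_self, mul_zero]
  have hδz : δ z = 0 := hδ.map_eq_zero_of_mul_eq hp hpz hzp
  have hδxz : δ (x * z) = 0 := hδ.map_eq_zero_of_mul_eq hp
    (by rw [← hpz, ← mul_assoc x, ← hinv, ← mul_assoc, ← mul_assoc, ← mul_assoc, hp.eq])
    (by rw [mul_assoc, hzp, mul_zero])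
  have hδzx : δ (z * x) = 0 := hδ.map_eq_zero_of_mul_eq hp
    (by rw [← mul_assoc, hpz])
    (by rw [mul_assoc, ← hinv, ← mul_assoc, ← mul_assoc, hzp, zero_mul, zero_mul])
  have h := hδ.map_mul_add_mul x z
  rw [map_add, hδxz, hδzx, hδz, mul_zero, add_zero, zero_add] at h
  rw [← hz]
  refine (isUnit_two R A).mul_left_cancel ?_
  rw [← mul_assoc, ← h, mul_zero]

lemma map_aeval (p : ℤ[X]) (x : A) : δ (aeval x p) = aeval x (derivative p) * δ x := by
  induction p using Polynomial.induction_on' with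
  | add p q hp hq => rw [map_add, map_add, hp, hq, derivative_add, map_add, add_mul]
  | monomial n a =>
    rw [aeval_monomial, derivative_monomial, aeval_monomial, ← Algebra.smul_def, map_zsmul]
    cases n with
    | zero => simp [hδ.map_one]
    | succ n =>
      rw [hδ.map_pow_succ, Nat.add_sub_cancel]
      simp [mul_assoc, Algebra.smul_def]

lemma sq_zsmul_map (x : A) (n : ℤ) :
    n ^ 2 • δ x =
      n • (aeval x ((1 - X ^ 2) * U ℤ (n - 1)) * δ (aeval x (T ℤ n))
        - aeval x (T ℤ n) * δ (aeval x ((1 - X ^ 2) * U ℤ (n - 1))))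
      - x * aeval x (T ℤ n) * δ (aeval x (T ℤ n)) := by
  have h := congrArg (fun p ↦ aeval x p * δ x) (chebyshev_wronskian n)
  generalize (1 - X ^ 2) * U ℤ (n - 1) = S at h ⊢
  simp only [map_sub, map_mul, aeval_X, map_pow, map_intCast, sub_mul, mul_sub, mul_assoc,
    ← hδ.map_aeval] at h
  simp only [zsmul_eq_mul, Int.cast_pow, mul_sub, mul_assoc]
  exact h.symm

end TwoInvertible

end IsJordanLeftDerivation

lemma eq_zero_of_forall_mul_norm_le {E : Type*} [NormedAddGroup E] {v : E} {C : ℝ}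
    (h : ∀ n : ℕ, n * ‖v‖ ≤ C) : v = 0 := by
  by_contra hv
  obtain ⟨n, hn⟩ := exists_nat_gt (C / ‖v‖)
  exact (h n).not_gt ((div_lt_iff₀ (norm_pos_iff.2 hv)).1 hn)

namespace IsJordanLeftDerivation

section Banach

open NormedSpace Polynomial Chebyshev
open scoped Nat

variable {𝕜 A : Type*} [RCLike 𝕜] [NormedRing A] [NormedAlgebra 𝕜 A] {δ : A →L[𝕜] A}
  (hδ : IsJordanLeftDerivation δ)
include hδ

lemma map_exp [CompleteSpace A] (x : A) : δ (exp x) = exp x * δ x := by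
  have hsum := exp_series_hasSum_exp' (𝕂 := 𝕜) x
  have hterm (n : ℕ) : δ (((n + 1)! : 𝕜)⁻¹ • x ^ (n + 1)) = (n ! : 𝕜)⁻¹ • x ^ n * δ x := by
    have hn : (n + 1 : 𝕜) ≠ 0 := Nat.cast_add_one_ne_zero n
    rw [map_smul, hδ.map_pow_succ, ← Nat.cast_smul_eq_nsmul 𝕜, smul_smul, smul_mul_assoc]
    congr 1
    rw [Nat.factorial_succ]
    push_cast
    field_simp
  have htail : HasSum (fun n ↦ δ ((n ! : 𝕜)⁻¹ • x ^ n)) (exp x * δ x) := by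
    rw [← hasSum_nat_add_iff' 1]
    simpa only [hterm, Finset.sum_range_one, Nat.factorial_zero, Nat.cast_one, inv_one, pow_zero,
      one_smul, hδ.map_one, sub_zero] using hsum.mul_right (δ x)
  exact (δ.hasSum hsum).unique htail

lemma map_eq_zero_of_norm_exp_nsmul_le [CompleteSpace A] {k : A} {C : ℝ}
    (hexp : ∀ n : ℕ, ‖exp (n • k)‖ ≤ C) (hexp_neg : ∀ n : ℕ, ‖exp (-(n • k))‖ ≤ C) : δ k = 0 := by
  refine eq_zero_of_forall_mul_norm_le (C := C * (‖δ‖ * C)) fun n ↦ ?_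
  let : NormedAlgebra ℚ A := NormedAlgebra.restrictScalars ℚ 𝕜 A
  have hinv : exp (-(n • k)) * exp (n • k) = 1 := by
    rw [← exp_add_of_commute (Commute.refl _).neg_left, neg_add_cancel, exp_zero]
  have hk : n • δ k = exp (-(n • k)) * δ (exp (n • k)) := by
    rw [hδ.map_exp, ← mul_assoc, hinv, one_mul, map_nsmul]
  calc n * ‖δ k‖ = ‖n • δ k‖ := by rw [RCLike.norm_nsmul 𝕜, nsmul_eq_mul]
    _ ≤ C * (‖δ‖ * C) := hk ▸ norm_mul_le_of_le (hexp_neg n) (δ.le_opNorm_of_le (hexp n))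

lemma map_eq_zero_of_norm_aeval_chebyshev_le {h : A} {C : ℝ}
    (hC : ∀ n : ℤ, ‖aeval h (T ℤ n)‖ ≤ C) : δ h = 0 := by
  have hC_nonneg : 0 ≤ C := (norm_nonneg _).trans (hC 0)
  refine eq_zero_of_forall_mul_norm_le (C := 3 * (‖h‖ * C + C) * (‖δ‖ * C)) fun n ↦ ?_
  obtain rfl | hn := n.eq_zero_or_pos
  · simp only [Nat.cast_zero, zero_mul]
    positivity
  have hS : ‖aeval h ((1 - X ^ 2) * U ℤ (n - 1))‖ ≤ ‖h‖ * C + C := by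
    rw [one_sub_X_sq_mul_U_eq_pol_in_T, sub_add_cancel, map_sub, map_mul, aeval_X]
    exact norm_sub_le_of_le (norm_mul_le_of_le le_rfl (hC _)) (hC _)
  have hδT : ‖δ (aeval h (T ℤ n))‖ ≤ ‖δ‖ * C := δ.le_opNorm_of_le (hC n)
  have hsq : (n : ℝ) ^ 2 * ‖δ h‖ ≤ n * ((‖h‖ * C + C) * (‖δ‖ * C) + C * (‖δ‖ * (‖h‖ * C + C)))
      + ‖h‖ * C * (‖δ‖ * C) := by
    calc (n : ℝ) ^ 2 * ‖δ h‖ = ‖(n : ℤ) ^ 2 • δ h‖ := by rw [norm_zsmul 𝕜]; simp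
      _ ≤ _ := by
        rw [hδ.sq_zsmul_map]
        refine norm_sub_le_of_le ?_ (norm_mul_le_of_le (norm_mul_le_of_le le_rfl (hC n)) hδT)
        rw [natCast_zsmul, RCLike.norm_nsmul 𝕜, nsmul_eq_mul]
        gcongr
        exact norm_sub_le_of_le (norm_mul_le_of_le hS hδT)
          (norm_mul_le_of_le (hC n) (δ.le_opNorm_of_le hS))
  have hn' : (1 : ℝ) ≤ n := Nat.one_le_cast.2 hn
  have hbound : ‖h‖ * C * (‖δ‖ * C) ≤ n * ((‖h‖ * C + C) * (‖δ‖ * C)) :=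
    (mul_le_mul_of_nonneg_right (le_add_of_nonneg_right hC_nonneg) (by positivity)).trans
      (le_mul_of_one_le_left (by positivity) hn')
  refine le_of_mul_le_mul_left ?_ (zero_lt_one.trans_le hn')
  linarith

end Banach

end IsJordanLeftDerivation

section Operators

open NormedSpace Polynomial Chebyshev

lemma isSelfAdjoint_aeval {A : Type*} [Ring A] [StarRing A] {a : A} (ha : IsSelfAdjoint a)
    (p : ℤ[X]) : IsSelfAdjoint (aeval a p) := by
  induction p using Polynomial.induction_on' with
  | add p q hp hq => rw [map_add]; exact hp.add hq
  | monomial n c =>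
    rw [aeval_monomial, ← Algebra.smul_def, isSelfAdjoint_iff, star_zsmul, (ha.pow n).star_eq]

lemma coe_exp {𝕜 A : Type*} [RCLike 𝕜] [NormedRing A] [NormedAlgebra 𝕜 A] (S : Subalgebra 𝕜 A)
    [CompleteSpace S] (x : S) : ((exp x : S) : A) = exp (x : A) := by
  let : NormedAlgebra ℚ A := NormedAlgebra.restrictScalars ℚ 𝕜 A
  let : NormedAlgebra ℚ S := NormedAlgebra.restrictScalars ℚ 𝕜 S
  exact NormedSpace.map_exp S.val continuous_subtype_val x

variable {𝕜 H : Type*} [RCLike 𝕜] [NormedAddCommGroup H] [InnerProductSpace 𝕜 H]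
  [CompleteSpace H]

lemma norm_aeval_chebyshev_le_one {h : H →L[𝕜] H} (hh : IsSelfAdjoint h) (hnorm : ‖h‖ ≤ 1)
    (n : ℤ) : ‖aeval h (T ℤ n)‖ ≤ 1 := by
  refine ContinuousLinearMap.opNorm_le_bound _ zero_le_one fun x ↦ ?_
  have hsq (p : ℤ[X]) : ‖aeval h p x‖ ^ 2 = RCLike.re (inner 𝕜 (aeval h (p ^ 2) x) x) := by
    rw [ContinuousLinearMap.apply_norm_sq_eq_inner_adjoint_left,
      ← ContinuousLinearMap.star_eq_adjoint, (isSelfAdjoint_aeval hh p).star_eq, map_pow, sq]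
    rfl
  have hpell : ‖aeval h (T ℤ n) x‖ ^ 2 + ‖aeval h (U ℤ (n - 1)) x‖ ^ 2
      = ‖x‖ ^ 2 + ‖h (aeval h (U ℤ (n - 1)) x)‖ ^ 2 := by
    have hpoly : T ℤ n ^ 2 + U ℤ (n - 1) ^ 2 = 1 ^ 2 + (X * U ℤ (n - 1)) ^ 2 := by
      linear_combination chebyshev_pell n
    have hre := congrArg (fun p : ℤ[X] ↦ RCLike.re (inner 𝕜 (aeval h p x) x)) hpoly
    simp only [map_add, add_apply, inner_add_left, ← hsq] at hre
    simpa only [map_one, map_mul, aeval_X, mul_apply_eq_comp, one_apply_eq_self] using hre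
  have hle : ‖h (aeval h (U ℤ (n - 1)) x)‖ ≤ ‖aeval h (U ℤ (n - 1)) x‖ :=
    (h.le_of_opNorm_le hnorm _).trans_eq (one_mul _)
  rw [one_mul]
  refine le_of_sq_le_sq ?_ (norm_nonneg x)
  nlinarith [pow_le_pow_left₀ (norm_nonneg _) hle 2]

lemma norm_exp_le_one {k : H →L[𝕜] H} (hk : k ∈ skewAdjoint (H →L[𝕜] H)) : ‖exp k‖ ≤ 1 := by
  let : NormedAlgebra ℚ (H →L[𝕜] H) := NormedAlgebra.restrictScalars ℚ 𝕜 _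
  have hu : exp k ∈ unitary (H →L[𝕜] H) := exp_mem_unitary_of_mem_skewAdjoint hk
  refine ContinuousLinearMap.opNorm_le_bound _ zero_le_one fun x ↦ ?_
  rw [one_mul, ContinuousLinearMap.norm_map_of_mem_unitary hu]

namespace IsJordanLeftDerivation

variable {S : Subalgebra 𝕜 (H →L[𝕜] H)} {δ : S →L[𝕜] S} (hδ : IsJordanLeftDerivation δ)
include hδ

lemma map_eq_zero_of_isSelfAdjoint {h : S} (hh : IsSelfAdjoint (h : H →L[𝕜] H)) : δ h = 0 := by
  have hunit {h : S} (hh : IsSelfAdjoint (h : H →L[𝕜] H)) (hnorm : ‖h‖ ≤ 1) : δ h = 0 := by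
    refine hδ.map_eq_zero_of_norm_aeval_chebyshev_le (C := 1) fun n ↦ ?_
    have hval : ((aeval h (T ℤ n) : S) : H →L[𝕜] H) = aeval (h : H →L[𝕜] H) (T ℤ n) :=
      (aeval_algHom_apply S.val.toRingHom.toIntAlgHom h (T ℤ n)).symm
    exact (congrArg norm hval).trans_le (norm_aeval_chebyshev_le_one hh hnorm n)
  obtain ⟨c, hc, hlt⟩ := exists_pos_norm_smul_lt_one 𝕜 h
  have hscaled : δ ((c : 𝕜) • h) = 0 :=
    hunit (IsSelfAdjoint.smul (by simp [IsSelfAdjoint]) hh) hlt.le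
  rw [map_smul] at hscaled
  exact (smul_eq_zero.1 hscaled).resolve_left (RCLike.ofReal_ne_zero.2 hc.ne')

lemma map_eq_zero_of_mem_skewAdjoint [CompleteSpace S] {k : S}
    (hk : (k : H →L[𝕜] H) ∈ skewAdjoint (H →L[𝕜] H)) : δ k = 0 := by
  have hexp {k : S} (hk : (k : H →L[𝕜] H) ∈ skewAdjoint (H →L[𝕜] H)) : ‖exp k‖ ≤ 1 :=
    (congrArg norm (coe_exp S k)).trans_le (norm_exp_le_one hk)
  exact hδ.map_eq_zero_of_norm_exp_nsmul_le (fun n ↦ hexp (nsmul_mem hk n))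
    fun n ↦ hexp (neg_mem (nsmul_mem hk n))

lemma map_eq_zero_of_star_mem [CompleteSpace S] {x : S} (hx : star (x : H →L[𝕜] H) ∈ S) :
    δ x = 0 := by
  obtain ⟨y, hy⟩ : ∃ y : S, (y : H →L[𝕜] H) = star (x : H →L[𝕜] H) := ⟨⟨_, hx⟩, rfl⟩
  have hadd : δ (x + y) = 0 := hδ.map_eq_zero_of_isSelfAdjoint (by
    rw [Subalgebra.coe_add, hy]
    exact IsSelfAdjoint.add_star_self _)
  have hsub : δ (x - y) = 0 := hδ.map_eq_zero_of_mem_skewAdjoint (by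
    rw [skewAdjoint.mem_iff, Subalgebra.coe_sub, hy, star_sub, star_star, neg_sub])
  refine (isUnit_two 𝕜 S).mul_left_cancel ?_
  rw [map_add] at hadd
  rw [map_sub] at hsub
  linear_combination (norm := noncomm_ring) hadd + hsub

end IsJordanLeftDerivation

end Operators

section LatticeAlg

variable {𝕜 H : Type*} [RCLike 𝕜] [NormedAddCommGroup H] [InnerProductSpace 𝕜 H]
  {L : Set (ClosedSubmodule 𝕜 H)} {M : ClosedSubmodule 𝕜 H} {T : H →L[𝕜] H}

lemma isClosed_latticeAlg (L : Set (ClosedSubmodule 𝕜 H)) :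
    IsClosed (latticeAlg L : Set (H →L[𝕜] H)) := by
  have hinter : (latticeAlg L : Set (H →L[𝕜] H)) = ⋂ M ∈ L, ⋂ x ∈ M, {T | T x ∈ M} := by
    ext T
    simp only [Set.mem_iInter, Set.mem_ofPred_eq]
    rfl
  rw [hinter]
  exact isClosed_biInter fun M _ ↦ isClosed_biInter fun x _ ↦
    M.isClosed.preimage (ContinuousLinearMap.apply 𝕜 H x).continuous

/-- The joint kernel of the corners `P T (1 - P)`, for `T ∈ Alg L` and `P` the projection onto a
member of `L`. A Jordan left derivation of `Alg L` takes values in the operators with range in this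
subspace. -/
noncomputable def offDiagonalKernel [CompleteSpace H] (L : Set (ClosedSubmodule 𝕜 H)) :
    ClosedSubmodule 𝕜 H :=
  ⨅ M ∈ L, ⨅ T ∈ latticeAlg L,
    (⊥ : ClosedSubmodule 𝕜 H).comap
      (M.toSubmodule.starProjection * T * (1 - M.toSubmodule.starProjection))

variable [CompleteSpace H]

lemma starProjection_mul_eq_self_iff {S : H →L[𝕜] H} :
    M.toSubmodule.starProjection * S = S ↔ ∀ x, S x ∈ M := by
  simp only [ContinuousLinearMap.ext_iff, mul_apply_eq_comp,
    Submodule.starProjection_eq_self_iff, ClosedSubmodule.mem_toSubmodule_iff]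

lemma mem_latticeAlg_of_forall_commute
    (hT : ∀ M ∈ L, Commute T M.toSubmodule.starProjection) : T ∈ latticeAlg L := by
  intro M hM x hx
  have hTx : M.toSubmodule.starProjection (T x) = T x := by
    rw [← mul_apply_eq_comp, ← (hT M hM).eq, mul_apply_eq_comp,
      Submodule.starProjection_eq_self_iff.2 hx]
  exact Submodule.starProjection_eq_self_iff.1 hTx

lemma star_mem_latticeAlg_of_forall_commute
    (hT : ∀ M ∈ L, Commute T M.toSubmodule.starProjection) : star T ∈ latticeAlg L :=
  mem_latticeAlg_of_forall_commute fun M hM ↦ by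
    simpa only [(isSelfAdjoint_starProjection M.toSubmodule).star_eq] using (hT M hM).star_star

lemma IsCSL.starProjection_mem_latticeAlg (hL : IsCSL L) (hM : M ∈ L) :
    M.toSubmodule.starProjection ∈ latticeAlg L :=
  mem_latticeAlg_of_forall_commute (hL.commute M hM)

lemma starProjection_mul_mul_starProjection (hT : T ∈ latticeAlg L) (hM : M ∈ L) :
    M.toSubmodule.starProjection * T * M.toSubmodule.starProjection
      = T * M.toSubmodule.starProjection := by
  rw [mul_assoc, starProjection_mul_eq_self_iff]
  exact fun x ↦ hT M hM _ (Submodule.starProjection_apply_mem _ x)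

lemma starProjection_offDiagonalKernel_mul_eq_self_iff {S : H →L[𝕜] H} :
    (offDiagonalKernel L).toSubmodule.starProjection * S = S ↔ ∀ M ∈ L, ∀ T ∈ latticeAlg L,
      M.toSubmodule.starProjection * T * (1 - M.toSubmodule.starProjection) * S = 0 := by
  rw [starProjection_mul_eq_self_iff]
  simp only [offDiagonalKernel, ClosedSubmodule.mem_iInf, ClosedSubmodule.mem_comap,
    ClosedSubmodule.mem_bot, ContinuousLinearMap.ext_iff, mul_apply_eq_comp, zero_apply]
  tauto

lemma corner_mul_starProjection_offDiagonalKernel (hT : T ∈ latticeAlg L) (hM : M ∈ L) :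
    M.toSubmodule.starProjection * T * (1 - M.toSubmodule.starProjection)
      * (offDiagonalKernel L).toSubmodule.starProjection = 0 :=
  starProjection_offDiagonalKernel_mul_eq_self_iff.1
    (Submodule.isIdempotentElem_starProjection _) M hM T hT

lemma IsCSL.commute_starProjection_offDiagonalKernel (hL : IsCSL L) (hM : M ∈ L) :
    Commute (offDiagonalKernel L).toSubmodule.starProjection M.toSubmodule.starProjection := by
  have hEPE : (offDiagonalKernel L).toSubmodule.starProjection
      * (M.toSubmodule.starProjection * (offDiagonalKernel L).toSubmodule.starProjection)
      = M.toSubmodule.starProjection * (offDiagonalKernel L).toSubmodule.starProjection := by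
    rw [starProjection_offDiagonalKernel_mul_eq_self_iff]
    intro N hN T hT
    have hTM := corner_mul_starProjection_offDiagonalKernel
      (mul_mem hT (hL.starProjection_mem_latticeAlg hM)) hN
    linear_combination (norm := noncomm_ring) hTM + N.toSubmodule.starProjection * T
      * (hL.commute M hM N hN).eq * (offDiagonalKernel L).toSubmodule.starProjection
  have hstar := congrArg star hEPE
  rw [star_mul, star_mul, (isSelfAdjoint_starProjection _).star_eq,
    (isSelfAdjoint_starProjection _).star_eq, mul_assoc, hEPE] at hstar
  exact hstar.symm

lemma IsCSL.commute_compression (hL : IsCSL L) (hT : T ∈ latticeAlg L) (hM : M ∈ L) :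
    Commute ((offDiagonalKernel L).toSubmodule.starProjection * T *
      (offDiagonalKernel L).toSubmodule.starProjection) M.toSubmodule.starProjection := by
  have hcorner := corner_mul_starProjection_offDiagonalKernel hT hM
  have hinv := starProjection_mul_mul_starProjection hT hM
  have hEP := (hL.commute_starProjection_offDiagonalKernel hM).eq
  generalize (offDiagonalKernel L).toSubmodule.starProjection = E at *
  generalize M.toSubmodule.starProjection = P at *
  have hPTE : P * T * E = T * P * E := by
    linear_combination (norm := noncomm_ring) hcorner + hinv * E
  calc E * T * E * P = E * (T * P * E) := by
        rw [mul_assoc (E * T), hEP, mul_assoc, mul_assoc T]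
    _ = P * (E * T * E) := by
        rw [← hPTE, ← mul_assoc, ← mul_assoc, hEP, mul_assoc, mul_assoc, mul_assoc]

lemma IsJordanLeftDerivation.eq_zero_of_isCSL (hL : IsCSL L) {δ : latticeAlg L →L[𝕜] latticeAlg L}
    (hδ : IsJordanLeftDerivation δ) : δ = 0 := by
  have : CompleteSpace (latticeAlg L) := (isClosed_latticeAlg L).completeSpace_coe
  obtain ⟨e, he⟩ : ∃ e : latticeAlg L,
      (e : H →L[𝕜] H) = (offDiagonalKernel L).toSubmodule.starProjection :=
    ⟨⟨_, mem_latticeAlg_of_forall_commute fun _ ↦ hL.commute_starProjection_offDiagonalKernel⟩, rfl⟩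
  have hidem : IsIdempotentElem e := Subtype.ext (by
    rw [Subalgebra.coe_mul, he]
    exact Submodule.isIdempotentElem_starProjection _)
  ext1 x
  have hrange : e * δ x = δ x := by
    refine Subtype.ext ?_
    rw [Subalgebra.coe_mul, he, starProjection_offDiagonalKernel_mul_eq_self_iff]
    intro M hM T hT
    obtain ⟨p, hp⟩ : ∃ p : latticeAlg L, (p : H →L[𝕜] H) = M.toSubmodule.starProjection :=
      ⟨⟨_, hL.starProjection_mem_latticeAlg hM⟩, rfl⟩
    have hcorner : p * ⟨T, hT⟩ * (1 - p) * δ x = 0 := hδ.mul_mul_one_sub_mul_map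
      (Subtype.ext (by
        rw [Subalgebra.coe_mul, hp]
        exact Submodule.isIdempotentElem_starProjection _))
      (fun S ↦ Subtype.ext (by
        simpa only [Subalgebra.coe_mul, hp] using starProjection_mul_mul_starProjection S.2 hM))
      _ _
    simpa only [Subalgebra.coe_mul, Subalgebra.coe_sub, Subalgebra.coe_one, Subalgebra.coe_zero, hp]
      using congrArg Subtype.val hcorner
  have hcompression : δ (e * x * e) = 0 := hδ.map_eq_zero_of_star_mem (by
    rw [Subalgebra.coe_mul, Subalgebra.coe_mul, he]
    exact star_mem_latticeAlg_of_forall_commute fun _ ↦ hL.commute_compression x.2)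
  rw [← hrange, ← hδ.map_idempotent_mul_mul hidem, hcompression, zero_apply]

end LatticeAlg

theorem corollary2p4 {𝕜 : Type*} [RCLike 𝕜] :
    (∀ (H : Type*) [NormedAddCommGroup H] [InnerProductSpace 𝕜 H] [CompleteSpace H]
        (L : Set (ClosedSubmodule 𝕜 H)), IsCSL L →
        ∀ δ : latticeAlg L →L[𝕜] latticeAlg L, IsJordanLeftDerivableAtOne δ → δ = 0) ∧
    (∀ (A : Type*) [NormedRing A] [NormedAlgebra 𝕜 A] [CompleteSpace A],
        Ring.jacobson A = ⊥ →
        ∀ δ : A →L[𝕜] A, IsJordanLeftDerivableAtOne δ → δ = 0) := by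
  refine ⟨fun H _ _ _ L hL δ hδ ↦ ?_, fun A _ _ _ hA δ hδ ↦ ?_⟩
  · have : CompleteSpace (latticeAlg L) := (isClosed_latticeAlg L).completeSpace_coe
    exact IsJordanLeftDerivation.eq_zero_of_isCSL hL (hδ.isJordanLeftDerivation (𝕜 := 𝕜))
  · exact IsJordanLeftDerivation.eq_zero_of_jacobson_eq_bot (hδ.isJordanLeftDerivation (𝕜 := 𝕜)) hA
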